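/- Let $\mathcal U$ be a real Banach space with dual $\mathcal U^*$ and duality pairing $[\cdot,\cdot]$, and let $\mathcal K:\mathcal U^*\to\mathcal U$ be a linear bijection that is symmetric ($[\psi,\mathcal K\varphi]=[\varphi,\mathcal K\psi]$) and positive ($[\varphi,\mathcal K\varphi]>0$ for $\varphi\ne0$), such that $\|u\|_{\mathcal U}^2=[\mathcal K^{-1}u,u]$ for all $u\in\mathcal U$. For a finite vector $\boldsymbol\psi=(\psi_i)_i$ of elements of $\mathcal U^*$, write $\mathcal K\boldsymbol\psi=(\mathcal K\psi_i)_i$, and let $\mathcal K(\boldsymbol\psi,\boldsymbol\psi)$ be the Gram matrix with entries $[\psi_i,\mathcal K\psi_j]$. Let $\Omega\subset\mathbb R^d$ be bounded and open, and let $L_1,\dots,L_{D_b}:\mathcal U\to C(\partial\Omega)$ and $L_{D_b+1},\dots,L_D:\mathcal U\to C(\Omega)$ be bounded linear operators. Let $\boldsymbol x_1,\dots,\boldsymbol x_{N_\Omega}\in\Omega$ be the interior samples and $\boldsymbol y_1,\dots,\boldsymbol y_{N_{\partial\Omega}}\in\partial\Omega$ the boundary samples. Let $\boldsymbol\psi_\Omega$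 consist of the functionals $\delta_{\boldsymbol x_j}\circ L_i$ ($1\le j\le N_\Omega$, $D_b<i\le D$), let $\boldsymbol\psi_{\partial\Omega}$ consist of the functionals $\delta_{\boldsymbol y_j}\circ L_i$ ($1\le j\le N_{\partial\Omega}$, $1\le i\le D_b$), and let $\boldsymbol\psi=(\boldsymbol\psi_\Omega,\boldsymbol\psi_{\partial\Omega})$. Let the interior inducing points $\widehat{\boldsymbol x}_1,\dots,\widehat{\boldsymbol x}_{M_\Omega}$ ($M_\Omega\ge1$) be drawn independently and uniformly from the interior samples, and the boundary inducing points $\widehat{\boldsymbol y}_1,\dots,\widehat{\boldsymbol y}_{M_{\partial\Omega}}$ ($M_{\partial\Omega}\ge1$) independently and uniformly from the boundary samples, and let $\boldsymbol\phi$ consist of the functionals $\delta_{\widehat{\boldsymbol x}_j}\circ L_i$ ($i>D_b$) and $\delta_{\widehat{\boldsymbol y}_j}\circ L_i$ ($i\le D_b$). Put $$\mathcal H_a=\operatorname{span}\{\mathcal K\boldsymbol\phi\},\qquad \mathcal H_b=\{\boldsymbol\beta^T\mathcal K\boldsymbol\psi:\ |\boldsymbol\beta|\le1\},\qquad \mathcal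 E(\mathcal H_a)=\max_{h\in\mathcal H_b}\min_{v\in\mathcal H_a}\|v-h\|_{\mathcal U}^2 .$$ Let $R_1=N_\Omega(D-D_b)$ and $R_2=N_{\partial\Omega}D_b$, and let $\lambda_1\ge\dots\ge\lambda_{R_1}$ and $\tau_1\ge\dots\ge\tau_{R_2}$ be the eigenvalues of $\mathcal K(\boldsymbol\psi_\Omega,\boldsymbol\psi_\Omega)$ and $\mathcal K(\boldsymbol\psi_{\partial\Omega},\boldsymbol\psi_{\partial\Omega})$, with $\lambda_{R_1+1}=\tau_{R_2+1}=0$. Assume that for some $C_0>0$ and every sample point $\boldsymbol x$ one has $\operatorname{trace}\mathcal K(\boldsymbol\psi^{\boldsymbol x},\boldsymbol\psi^{\boldsymbol x})\le C_0$, where $\boldsymbol\psi^{\boldsymbol x}$ is the vector of those functionals of $\boldsymbol\psi$ that belong to $\boldsymbol x$. Then there is a constant $C>0$, depending only on $C_0$, such that for every $\delta\in(0,1)$, with probability at least $1-\delta$, for all integers $0\le r_1\le R_1$ and $0\le r_2\le R_2$ simultaneously, $$\mathcal E(\mathcal H_a)\le\max\Big\{\frac{C N_\Omega^2\ln^2(2/\delta)}{\lambda_{r_1}M_\Omega},\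 \frac{C N_{\partial\Omega}^2\ln^2(2/\delta)}{\tau_{r_2}M_{\partial\Omega}}\Big\}+4\lambda_{r_1+1}+4\tau_{r_2+1}.$$ Here a term of the maximum is read as $0$ if its index $r_1$ or $r_2$ is $0$, and as $+\infty$ if $r_1\ge1$ and $\lambda_{r_1}=0$, or $r_2\ge1$ and $\tau_{r_2}=0$. -/

import Mathlib

universe u v

noncomputable section

namespace Nystrom

open MeasureTheory ProbabilityTheory

section Space

variable {U : Type u} [NormedAddCommGroup U] [NormedSpace ℝ U]

/-- A linear bijection `𝒦 : U* → U` is a covariance operator of `U` if it is symmetric, positive,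
and the norm of `U` is the quadratic norm `‖u‖² = [𝒦⁻¹ u, u]`. -/
structure IsCovarianceOperator (𝒦 : StrongDual ℝ U ≃ₗ[ℝ] U) : Prop where
  symm : ∀ φ ψ : StrongDual ℝ U, ψ (𝒦 φ) = φ (𝒦 ψ)
  pos : ∀ φ : StrongDual ℝ U, φ ≠ 0 → 0 < φ (𝒦 φ)
  norm_sq : ∀ x : U, ‖x‖ ^ 2 = (𝒦.symm x) x

/-- The Gram matrix `𝒦(ψ, ψ)`, with entries `[ψ_i, 𝒦 ψ_j]`. -/
def gram {ι : Type*} (𝒦 : StrongDual ℝ U ≃ₗ[ℝ] U) (ψ : ι → StrongDual ℝ U) : Matrix ι ι ℝ :=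
  Matrix.of fun i j => ψ i (𝒦 (ψ j))

theorem IsCovarianceOperator.gram_isHermitian {ι : Type*} {𝒦 : StrongDual ℝ U ≃ₗ[ℝ] U}
    (h𝒦 : IsCovarianceOperator 𝒦) (ψ : ι → StrongDual ℝ U) : (gram 𝒦 ψ).IsHermitian := by
  ext i j
  simp [gram, Matrix.conjTranspose_apply, h𝒦.symm (ψ i) (ψ j)]

/-- `sortedEigenvalue hA j` is the `j`-th eigenvalue (`1 ≤ j ≤ card n`, counted with multiplicity,
in descending order) of the Hermitian matrix `A`, extended by `0` to all other `j`; in particular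
the eigenvalue of index `card n + 1` is `0`. -/
def sortedEigenvalue {n : Type*} [Fintype n] [DecidableEq n] {A : Matrix n n ℝ}
    (hA : A.IsHermitian) (j : ℕ) : ℝ :=
  if h : 1 ≤ j ∧ j ≤ Fintype.card n then hA.eigenvalues₀ ⟨j - 1, by omega⟩ else 0

/-- The `j`-th eigenvalue, in descending order and starting from `j = 1`, of `𝒦(ψ, ψ)`. -/
def gramEigenvalue {ι : Type*} [Fintype ι] [DecidableEq ι] {𝒦 : StrongDual ℝ U ≃ₗ[ℝ] U}
    (h𝒦 : IsCovarianceOperator 𝒦) (ψ : ι → StrongDual ℝ U) (j : ℕ) : ℝ :=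
  sortedEigenvalue (h𝒦.gram_isHermitian ψ) j

/-- The functional `δ_x ∘ L`, where `L` maps into the continuous functions on `X`. -/
def pointFunctional {X : Type*} [TopologicalSpace X] (L : U →L[ℝ] C(X, ℝ)) (x : X) :
    StrongDual ℝ U :=
  (ContinuousMap.evalCLM ℝ x).comp L

/-- All functionals `δ_{x_j} ∘ L_i`, for points `x_j` and operators `L_i`. -/
def functionals {X : Type*} [TopologicalSpace X] {n D : ℕ} (L : Fin D → (U →L[ℝ] C(X, ℝ)))
    (x : Fin n → X) : Fin n × Fin D → StrongDual ℝ U :=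
  fun p => pointFunctional (L p.2) (x p.1)

/-- The interior functionals together with the boundary functionals. -/
def allFunctionals {X Y : Type*} [TopologicalSpace X] [TopologicalSpace Y] {n D m E : ℕ}
    (L : Fin D → (U →L[ℝ] C(X, ℝ))) (L' : Fin E → (U →L[ℝ] C(Y, ℝ)))
    (x : Fin n → X) (y : Fin m → Y) : (Fin n × Fin D) ⊕ (Fin m × Fin E) → StrongDual ℝ U :=
  Sum.elim (functionals L x) (functionals L' y)

/-- `H_a = span {𝒦 φ_i}`. -/
def Ha {κ : Type*} (𝒦 : StrongDual ℝ U ≃ₗ[ℝ] U) (φ : κ → StrongDual ℝ U) : Submodule ℝ U :=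
  Submodule.span ℝ (Set.range fun i => 𝒦 (φ i))

/-- `H_b = {βᵀ 𝒦 ψ : |β| ≤ 1}`, with the Euclidean norm of `β`. -/
def Hb {ι : Type*} [Fintype ι] (𝒦 : StrongDual ℝ U ≃ₗ[ℝ] U) (ψ : ι → StrongDual ℝ U) : Set U :=
  {h | ∃ β : EuclideanSpace ℝ ι, ‖β‖ ≤ 1 ∧ h = ∑ i, β i • 𝒦 (ψ i)}

/-- `E(h, H) = min_{v ∈ H} ‖v - h‖²`. -/
def approxError (h : U) (H : Submodule ℝ U) : ℝ :=
  ⨅ v : H, ‖(v : U) - h‖ ^ 2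

/-- The worst-case error `E(H_a) = max_{h ∈ H_b} E(h, H_a)`. -/
def worstError {ι κ : Type*} [Fintype ι] (𝒦 : StrongDual ℝ U ≃ₗ[ℝ] U)
    (ψ : ι → StrongDual ℝ U) (φ : κ → StrongDual ℝ U) : ℝ :=
  sSup ((fun h => approxError h (Ha 𝒦 φ)) '' Hb 𝒦 ψ)

end Space

/-- The random indices `I_1, …, I_m` are independent and uniformly distributed on the `n`
indices; the inducing points are then `x_{I_1}, …, x_{I_m}`, for the sample points
`x_1, …, x_n`. -/
structure IsUniformSample {S : Type v} [MeasurableSpace S] (P : Measure S) {m n : ℕ}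
    (I : Fin m → S → Fin n) : Prop where
  measurable : ∀ j, Measurable (I j)
  indep : iIndepFun I P
  uniform : ∀ j, P.map (I j) = uniformOn Set.univ

/-- The term `C n² ln²(2/δ) / (μ_r m)`, which is absent (that is, `0`) if `r = 0`. -/
def samplingTerm (C δ : ℝ) (n m : ℕ) (μ : ℕ → ℝ) (r : ℕ) : ℝ :=
  if r = 0 then 0 else C * (n : ℝ) ^ 2 * Real.log (2 / δ) ^ 2 / (μ r * (m : ℝ))

end Nystrom

end

/-! The form $\langle x,y\rangle=[\mathcal K^{-1}x,y]$ makes $\mathcal U$ a Hilbert space in which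
the Gram matrices are those of the vectors $k_i=\mathcal K\psi_i$. Interior and boundary are treated
separately, each with failure probability at most $\delta/2$.

On one side with $n$ samples, $m$ inducing points and eigenpairs $(\lambda_l,e_l)$ of the Gram
matrix, let $T=\sum_i k_i\otimes k_i$. The principal vectors $p_l=\sum_i e_l(i)k_i$ are orthogonal,
$\|p_l\|^2=\lambda_l$ and $Tp_l=\lambda_lp_l$. Expand $h=\sum_i\beta_ik_i$ in the $p_l$. Dropping
all but the top $r$ costs at most $\lambda_{r+1}|\beta|^2$ (`norm_sq_sum_sub_sum_le`). What remains
is $Tg$ with $\|g\|^2\le|\beta|^2/\lambda_r$. Replacing $T$ by $n/m$ times the sum $T_J$ of the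
point operators at the inducing points gives $v=(n/m)T_Jg$, which lies in the span of the sampled
vectors. The error is at most $(n/m)\|Z\|\|g\|$, where $Z=T_J-(m/n)T$ is a sum of $m$ independent
centred Hilbert-Schmidt operators of norm at most $2C_0$ (`exists_mem_span_norm_sub_le`).

A Hilbert-space tail bound controls $\|Z\|$: $\cosh\|\cdot\|$ grows on average by at most a factor
$1+b^2$ under a centred step of length at most $b\le1$ (`sum_cosh_norm_add_le`). The event bounding
$\|Z\|$ involves neither $r$ nor $\beta$, so the estimate holds for all of them at once. -/

namespace Nystrom

open MeasureTheory ProbabilityTheory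

/-! ### Tail bounds for sums of independent vectors in a Hilbert space. -/

section Concentration

variable {E : Type*} [NormedAddCommGroup E] [InnerProductSpace ℝ E]

/-- Convexity of `t ↦ cosh √t`, in the form of the chord inequality between `(a - b)²` and
`(a + b)²`. -/
theorem cosh_le_of_sq_eq {a b c s : ℝ} (hc : |c| ≤ 1)
    (hs : s ^ 2 = a ^ 2 + b ^ 2 + 2 * a * b * c) :
    Real.cosh s ≤ Real.cosh a * Real.cosh b + c * (Real.sinh a * Real.sinh b) := by
  obtain ⟨hc1, hc2⟩ := abs_le.1 hc
  have key : Real.cosh s ≤ (1 + c) / 2 * Real.cosh (a + b) + (1 - c) / 2 * Real.cosh (a - b) := by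
    -- The comparison is termwise in the power series: $s^2$ is the mean of $(a\pm b)^2$ with
    -- weights $(1\pm c)/2$, and $t\mapsto t^n$ is convex on $[0,\infty)$.
    refine hasSum_le (fun n => ?_) (Real.hasSum_cosh s)
      (((Real.hasSum_cosh (a + b)).mul_left _).add ((Real.hasSum_cosh (a - b)).mul_left _))
    have hconv : ConvexOn ℝ (Set.Ici 0) fun x : ℝ => x ^ n := convexOn_pow n
    have h := hconv.2 (Set.mem_Ici.2 (sq_nonneg (a + b))) (Set.mem_Ici.2 (sq_nonneg (a - b)))
      (show 0 ≤ (1 + c) / 2 by linarith) (show 0 ≤ (1 - c) / 2 by linarith) (by ring)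
    have e : (1 + c) / 2 * (a + b) ^ 2 + (1 - c) / 2 * (a - b) ^ 2 = s ^ 2 := by rw [hs]; ring
    simp only [smul_eq_mul, e] at h
    simp only [pow_mul, ← mul_div_assoc, ← add_div]
    gcongr
  rw [Real.cosh_add, Real.cosh_sub] at key
  linarith

/-- The first-order term is kept exactly linear in `y`, so that it vanishes on averaging over
centred `y`. With $c$ the cosine of the angle, replacing $\sinh b$ by $b$ in that term costs at most
$\cosh a\,(\sinh b-b)$, and $\cosh b+\sinh b-b=e^b-b\le1+b^2$ for $0\le b\le1$. -/
theorem cosh_norm_add_le (x : E) {y : E} (hy : ‖y‖ ≤ 1) :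
    Real.cosh ‖x + y‖ ≤
      Real.cosh ‖x‖ * (1 + ‖y‖ ^ 2) + Real.sinh ‖x‖ / ‖x‖ * inner ℝ x y := by
  set a := ‖x‖ with ha
  set b := ‖y‖ with hb
  have ha0 : 0 ≤ a := norm_nonneg x
  have hb0 : 0 ≤ b := norm_nonneg y
  have hexp : Real.cosh b + Real.sinh b - b ≤ 1 + b ^ 2 := by
    have := (abs_le.1 (Real.abs_exp_sub_one_sub_id_le (x := b) (by rwa [abs_of_nonneg hb0]))).2
    rw [Real.cosh_add_sinh]; linarith
  set c := inner ℝ x y / (a * b) with hc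
  have hc1 : |c| ≤ 1 := abs_real_inner_div_norm_mul_norm_le_one x y
  have hin : inner ℝ x y = a * b * c := by
    rcases eq_or_ne (a * b) 0 with h0 | h0
    · have := abs_real_inner_le_norm x y
      rw [← ha, ← hb, h0] at this
      rw [h0, zero_mul]; exact abs_nonpos_iff.1 this
    · rw [hc, mul_div_cancel₀ _ h0]
  have hs : ‖x + y‖ ^ 2 = a ^ 2 + b ^ 2 + 2 * a * b * c := by
    rw [norm_add_sq_real, hin]; ring
  have h1 := cosh_le_of_sq_eq hc1 hs
  have hsa : 0 ≤ Real.sinh a := Real.sinh_nonneg_iff.2 ha0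
  have hsb : b ≤ Real.sinh b := Real.self_le_sinh_iff.2 hb0
  have hsc : Real.sinh a ≤ Real.cosh a := (Real.sinh_lt_cosh a).le
  have h2 : Real.sinh a / a * inner ℝ x y = c * (Real.sinh a * b) := by
    rw [hin]
    rcases eq_or_ne a 0 with h0 | h0
    · simp [h0]
    · field_simp
  have h3 : c * (Real.sinh a * (Real.sinh b - b)) ≤ Real.cosh a * (Real.sinh b - b) := by
    have h4 : 0 ≤ Real.sinh a * (Real.sinh b - b) := mul_nonneg hsa (by linarith)
    have h5 := mul_le_mul_of_nonneg_right (abs_le.1 hc1).2 h4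
    have h6 := mul_le_mul_of_nonneg_right hsc (sub_nonneg.2 hsb)
    linarith
  have h7 := mul_le_mul_of_nonneg_left hexp (Real.cosh_pos a).le
  rw [h2]
  nlinarith

theorem sum_cosh_norm_add_le {κ : Type*} [Fintype κ] {X : κ → E} (hX : ∑ j, X j = 0) {b : ℝ}
    (hb1 : b ≤ 1) (hb : ∀ j, ‖X j‖ ≤ b) (x : E) :
    ∑ j, Real.cosh ‖x + X j‖ ≤ Fintype.card κ * (1 + b ^ 2) * Real.cosh ‖x‖ := by
  calc ∑ j, Real.cosh ‖x + X j‖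
      ≤ ∑ j, (Real.cosh ‖x‖ * (1 + b ^ 2) + Real.sinh ‖x‖ / ‖x‖ * inner ℝ x (X j)) := by
        refine Finset.sum_le_sum fun j _ => (cosh_norm_add_le x ((hb j).trans hb1)).trans ?_
        have := hb j
        have := Real.cosh_pos ‖x‖
        gcongr
    _ = Fintype.card κ * (1 + b ^ 2) * Real.cosh ‖x‖ := by
        rw [Finset.sum_add_distrib, ← Finset.mul_sum Finset.univ (fun j => inner ℝ x (X j)),
          ← inner_sum, hX]
        simp only [Finset.sum_const, Finset.card_univ, nsmul_eq_mul, inner_zero_right]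
        ring

theorem sum_cosh_norm_sum_le {κ : Type*} [Fintype κ] {X : κ → E} (hX : ∑ j, X j = 0) {b : ℝ}
    (hb1 : b ≤ 1) (hb : ∀ j, ‖X j‖ ≤ b) (m : ℕ) (x : E) :
    ∑ I : Fin m → κ, Real.cosh ‖x + ∑ k, X (I k)‖ ≤
      (Fintype.card κ * (1 + b ^ 2)) ^ m * Real.cosh ‖x‖ := by
  induction m generalizing x with
  | zero => simp
  | succ m ih =>
    rw [← (Fin.consEquiv fun _ : Fin (m + 1) => κ).sum_comp, Fintype.sum_prod_type]
    simp only [Fin.consEquiv_apply, Fin.sum_univ_succ, Fin.cons_zero, Fin.cons_succ, ← add_assoc]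
    calc _ ≤ ∑ j, (Fintype.card κ * (1 + b ^ 2)) ^ m * Real.cosh ‖x + X j‖ :=
          Finset.sum_le_sum fun j _ => ih (x + X j)
      _ ≤ (Fintype.card κ * (1 + b ^ 2)) ^ m *
            (Fintype.card κ * (1 + b ^ 2) * Real.cosh ‖x‖) := by
          rw [← Finset.mul_sum]
          exact mul_le_mul_of_nonneg_left (sum_cosh_norm_add_le hX hb1 hb x) (by positivity)
      _ = _ := by ring

/-- Markov's inequality for $\cosh$, in counting form. Scaling by $1/(B\sqrt m)$ makes each step at
most $1/\sqrt m$ long, so the growth over $m$ steps is $(1+1/m)^m\le e$; on the bad tuples $\cosh\ge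
e^t/2$. -/
theorem card_lt_norm_sum_le {κ : Type*} [Fintype κ] {X : κ → E} (hX : ∑ j, X j = 0) {B : ℝ}
    (hB : 0 < B) (hb : ∀ j, ‖X j‖ ≤ B) {m : ℕ} (hm : 0 < m) (t : ℝ) :
    (Nat.card {I : Fin m → κ // B * √m * t < ‖∑ k, X (I k)‖} : ℝ) ≤
      2 * Real.exp (1 - t) * Fintype.card κ ^ m := by
  classical
  have hm' : (1 : ℝ) ≤ √m := by
    rw [Real.one_le_sqrt]; exact_mod_cast hm
  have hBm : 0 < B * √m := by positivity
  set c := (B * √m)⁻¹ with hc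
  have hc0 : 0 < c := inv_pos.2 hBm
  have h := sum_cosh_norm_sum_le (X := fun j => c • X j) (by rw [← Finset.smul_sum, hX, smul_zero])
    (b := (√m)⁻¹) (inv_le_one_of_one_le₀ hm') (fun j => by
      rw [norm_smul, Real.norm_of_nonneg hc0.le]
      calc c * ‖X j‖ ≤ c * B := by gcongr; exact hb j
        _ = (√m)⁻¹ := by rw [hc]; field_simp) m 0
  simp only [zero_add, ← Finset.smul_sum, norm_zero, Real.cosh_zero, mul_one, norm_smul,
    Real.norm_of_nonneg hc0.le] at h
  have hpow : (1 + ((√m : ℝ)⁻¹) ^ 2) ^ m ≤ Real.exp 1 := by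
    rw [inv_pow, Real.sq_sqrt (Nat.cast_nonneg m)]
    calc (1 + (m : ℝ)⁻¹) ^ m ≤ (Real.exp ((m : ℝ)⁻¹)) ^ m := by
          gcongr; linarith [Real.add_one_le_exp ((m : ℝ)⁻¹)]
      _ = Real.exp 1 := by
          rw [← Real.exp_nat_mul, mul_inv_cancel₀ (by exact_mod_cast hm.ne')]
  rw [Nat.card_eq_fintype_card, Fintype.card_subtype]
  have h2 : ((Finset.univ.filter fun I : Fin m → κ => B * √m * t < ‖∑ k, X (I k)‖).card : ℝ) *
      (Real.exp t / 2) ≤ ∑ I : Fin m → κ, Real.cosh (c * ‖∑ k, X (I k)‖) := by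
    rw [← nsmul_eq_mul]
    refine (Finset.card_nsmul_le_sum _ _ _ fun I hI => ?_).trans
      (Finset.sum_le_univ_sum_of_nonneg fun I => (Real.cosh_pos _).le)
    have h3 : t ≤ c * ‖∑ k, X (I k)‖ := by
      rw [hc, inv_mul_eq_div, le_div_iff₀' hBm]
      exact (Finset.mem_filter.1 hI).2.le
    rw [Real.cosh_eq]
    have := Real.exp_le_exp.2 h3
    have := Real.exp_pos (-(c * ‖∑ k, X (I k)‖))
    linarith
  have h4 : ((Finset.univ.filter fun I : Fin m → κ => B * √m * t < ‖∑ k, X (I k)‖).card : ℝ) *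
      (Real.exp t / 2) ≤ Fintype.card κ ^ m * Real.exp 1 := by
    refine (h2.trans h).trans ?_
    rw [mul_pow]
    gcongr
  rw [Real.exp_sub]
  have := Real.exp_pos t
  rw [← le_div_iff₀ (by positivity)] at h4
  refine h4.trans (le_of_eq ?_)
  field_simp

/-- By independence all index tuples have the same mass, which turns probabilities into counts. -/
theorem IsUniformSample.map_singleton {S : Type*} [MeasurableSpace S] {P : Measure S}
    [IsProbabilityMeasure P] {m n : ℕ} {I : Fin m → S → Fin n} (hI : IsUniformSample P I)
    (J : Fin m → Fin n) :
    P ((fun s j => I j s) ⁻¹' {J}) = ((n : ENNReal) ^ m)⁻¹ := by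
  rw [← Measure.map_apply (measurable_pi_lambda _ hI.measurable) (MeasurableSet.singleton J),
    (iIndepFun_iff_map_fun_eq_pi_map fun j => (hI.measurable j).aemeasurable).1 hI.indep]
  have : ∀ j, IsProbabilityMeasure (P.map (I j)) := fun j =>
    Measure.isProbabilityMeasure_map (hI.measurable j).aemeasurable
  rw [Measure.pi_singleton]
  have h : ∀ j, P.map (I j) {J j} = (n : ENNReal)⁻¹ := fun j => by
    rw [hI.uniform, uniformOn_univ]
    simp
  simp [h, ENNReal.inv_pow]

/-- Sums of independent, uniformly sampled, centred and bounded vectors of a Hilbert space have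
subexponential tails. -/
theorem IsUniformSample.measure_lt_norm_sum_le {S : Type*} [MeasurableSpace S] {P : Measure S}
    [IsProbabilityMeasure P] {m n : ℕ} {I : Fin m → S → Fin n} (hI : IsUniformSample P I)
    (hm : 0 < m) (hn : 0 < n) {X : Fin n → E} (hX : ∑ j, X j = 0) {B : ℝ}
    (hB : 0 < B) (hb : ∀ j, ‖X j‖ ≤ B) (t : ℝ) :
    P {s | B * √m * t < ‖∑ k, X (I k s)‖} ≤ ENNReal.ofReal (2 * Real.exp (1 - t)) := by
  classical
  set F := Finset.univ.filter fun J : Fin m → Fin n => B * √m * t < ‖∑ k, X (J k)‖ with hF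
  have hset : {s | B * √m * t < ‖∑ k, X (I k s)‖} ⊆
      ⋃ J ∈ F, (fun s j => I j s) ⁻¹' {J} := fun s hs => by
    simp only [Set.mem_iUnion]
    exact ⟨fun j => I j s, by simpa [hF] using hs, rfl⟩
  refine (measure_mono hset).trans ((measure_biUnion_finset_le _ _).trans ?_)
  simp only [hI.map_singleton, Finset.sum_const, nsmul_eq_mul]
  have hc := card_lt_norm_sum_le hX hB hb hm t
  rw [Nat.card_eq_fintype_card, Fintype.card_subtype, Fintype.card_fin, ← hF] at hc
  have hn' : (0 : ℝ) < (n : ℝ) ^ m := by positivity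
  have e : (F.card : ENNReal) * ((n : ENNReal) ^ m)⁻¹ =
      ENNReal.ofReal (F.card * ((n : ℝ) ^ m)⁻¹) := by
    rw [ENNReal.ofReal_mul (by positivity), ENNReal.ofReal_inv_of_pos hn',
      ENNReal.ofReal_pow (by positivity), ENNReal.ofReal_natCast, ENNReal.ofReal_natCast]
  rw [e]
  refine ENNReal.ofReal_le_ofReal ?_
  rwa [← div_eq_mul_inv, div_le_iff₀ hn']

end Concentration

/-! ### Eigenvalues in descending order. -/

section Eigenvalues

variable {n : Type*} [Fintype n] [DecidableEq n] {A : Matrix n n ℝ}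

theorem sortedEigenvalue_nonneg (hA : A.IsHermitian) (h : ∀ l, 0 ≤ hA.eigenvalues l) (r : ℕ) :
    0 ≤ sortedEigenvalue hA r := by
  unfold sortedEigenvalue
  split_ifs with hr
  · have := h (Fintype.equivOfCardEq (Fintype.card_fin _) ⟨r - 1, by omega⟩)
    rwa [Matrix.IsHermitian.eigenvalues, Equiv.symm_apply_apply] at this
  · exact le_rfl

/-- The indices of the `r` largest eigenvalues. -/
theorem exists_finset_sortedEigenvalue (hA : A.IsHermitian) {r : ℕ}
    (hr : r = 0 ∨ 0 < sortedEigenvalue hA r) :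
    ∃ s : Finset n, (∀ l ∈ s, r ≠ 0 ∧ sortedEigenvalue hA r ≤ hA.eigenvalues l) ∧
      ∀ l ∉ s, hA.eigenvalues l ≤ sortedEigenvalue hA (r + 1) := by
  set pos : n ≃ Fin (Fintype.card n) :=
    (Fintype.equivOfCardEq (Fintype.card_fin (Fintype.card n))).symm
  have heig : ∀ l, hA.eigenvalues l = hA.eigenvalues₀ (pos l) := fun _ => rfl
  -- `pos` counts from 0 and `sortedEigenvalue` from 1, so position `r` carries the eigenvalue of
  -- index `r + 1`.
  refine ⟨Finset.univ.filter fun l => (pos l : ℕ) < r, fun l hl => ?_, fun l hl => ?_⟩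
  · have hl' : (pos l : ℕ) < r := (Finset.mem_filter.1 hl).2
    have hr0 : r ≠ 0 := by omega
    refine ⟨hr0, ?_⟩
    have hpos := hr.resolve_left hr0
    unfold sortedEigenvalue at hpos ⊢
    split_ifs at hpos ⊢ with h
    · rw [heig]
      exact hA.eigenvalues₀_antitone (Fin.le_def.2 (by simp only; omega))
    · exact absurd hpos (lt_irrefl _)
  · have hl' : r ≤ (pos l : ℕ) := by simpa using hl
    have := (pos l).2
    rw [heig, sortedEigenvalue, dif_pos ⟨by omega, by omega⟩]
    exact hA.eigenvalues₀_antitone (Fin.le_def.2 (by simpa using hl'))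

end Eigenvalues

/-! ### Spectral decomposition of the covariance operator. -/

section Spectral

/-- With `Z` read as the list of values of an operator at the normalized principal vectors, this
bounds its action by its Hilbert-Schmidt norm, through Cauchy-Schwarz. -/
theorem norm_sq_sum_smul_le {H ι : Type*} [SeminormedAddCommGroup H] [NormedSpace ℝ H]
    [Fintype ι] (c : ι → ℝ) (Z : PiLp 2 fun _ : ι => H) :
    ‖∑ l, c l • Z l‖ ^ 2 ≤ (∑ l, c l ^ 2) * ‖Z‖ ^ 2 := by
  rw [PiLp.norm_sq_eq_of_L2]
  calc ‖∑ l, c l • Z l‖ ^ 2 ≤ (∑ l, |c l| * ‖Z l‖) ^ 2 := by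
        gcongr
        refine (norm_sum_le _ _).trans (le_of_eq ?_)
        simp only [norm_smul, Real.norm_eq_abs]
    _ ≤ (∑ l, |c l| ^ 2) * ∑ l, ‖Z l‖ ^ 2 := Finset.sum_mul_sq_le_sq_mul_sq _ _ _
    _ = _ := by simp only [sq_abs]

variable {H : Type*} [NormedAddCommGroup H] [InnerProductSpace ℝ H]
  {ι : Type*} [Fintype ι] [DecidableEq ι] {A : Matrix ι ι ℝ}

/-- The combination of the vectors `k` whose coefficients are those of an eigenvector. -/
noncomputable def principal (hA : A.IsHermitian) (k : ι → H) (l : ι) : H :=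
  ∑ i, hA.eigenvectorBasis l i • k i

/-- The normalized principal vectors; they vanish if the eigenvalue does. -/
noncomputable def normalizedPrincipal (hA : A.IsHermitian) (k : ι → H) (l : ι) : H :=
  (√(hA.eigenvalues l))⁻¹ • principal hA k l

theorem inner_principal (hA : A.IsHermitian) {k : ι → H} (hk : ∀ i j, A i j = inner ℝ (k i) (k j))
    (i l : ι) :
    inner ℝ (k i) (principal hA k l) = hA.eigenvalues l * hA.eigenvectorBasis l i := by
  have h := congrFun (hA.mulVec_eigenvectorBasis l) i
  simp only [Matrix.mulVec, dotProduct, Pi.smul_apply, smul_eq_mul] at h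
  rw [← h, principal, inner_sum]
  refine Finset.sum_congr rfl fun j _ => ?_
  rw [real_inner_smul_right, hk, mul_comm]

theorem inner_principal_principal (hA : A.IsHermitian) {k : ι → H}
    (hk : ∀ i j, A i j = inner ℝ (k i) (k j)) (l m : ι) :
    inner ℝ (principal hA k l) (principal hA k m) = if l = m then hA.eigenvalues l else 0 := by
  have h := orthonormal_iff_ite.1 hA.eigenvectorBasis.orthonormal l m
  rw [PiLp.inner_apply] at h
  rw [principal, sum_inner]
  simp only [real_inner_smul_left, inner_principal hA hk]
  calc _ = hA.eigenvalues m *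
        ∑ i, inner ℝ (hA.eigenvectorBasis l i) (hA.eigenvectorBasis m i) := by
        rw [Finset.mul_sum]
        refine Finset.sum_congr rfl fun i _ => ?_
        simp only [RCLike.inner_apply, conj_trivial]
        ring
    _ = _ := by
        rw [h]
        split_ifs with hlm
        · rw [hlm, mul_one]
        · rw [mul_zero]

theorem eigenvalues_nonneg_of_gram (hA : A.IsHermitian) {k : ι → H}
    (hk : ∀ i j, A i j = inner ℝ (k i) (k j)) (l : ι) : 0 ≤ hA.eigenvalues l := by
  have h := inner_principal_principal hA hk l l
  rw [if_pos rfl] at h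
  rw [← h]
  exact real_inner_self_nonneg

theorem sum_inner_smul_principal (hA : A.IsHermitian) {k : ι → H}
    (hk : ∀ i j, A i j = inner ℝ (k i) (k j)) (l : ι) :
    ∑ i, inner ℝ (k i) (principal hA k l) • k i = hA.eigenvalues l • principal hA k l := by
  simp only [inner_principal hA hk, mul_smul, ← Finset.smul_sum]
  rfl

theorem sum_smul_eq_sum_smul_principal (hA : A.IsHermitian) (k : ι → H)
    (β : EuclideanSpace ℝ ι) :
    ∑ i, β i • k i = ∑ l, hA.eigenvectorBasis.repr β l • principal hA k l := by
  simp only [principal, Finset.smul_sum, smul_smul]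
  rw [Finset.sum_comm]
  refine Finset.sum_congr rfl fun i _ => ?_
  rw [← Finset.sum_smul]
  congr 1
  have h := congrArg (fun x : EuclideanSpace ℝ ι => x i) (hA.eigenvectorBasis.sum_repr β)
  simpa using h.symm

theorem norm_sq_sum_smul_principal (hA : A.IsHermitian) {k : ι → H}
    (hk : ∀ i j, A i j = inner ℝ (k i) (k j)) (w : ι → ℝ) :
    ‖∑ l, w l • principal hA k l‖ ^ 2 = ∑ l, w l ^ 2 * hA.eigenvalues l := by
  rw [← real_inner_self_eq_norm_sq, sum_inner]
  refine Finset.sum_congr rfl fun l _ => ?_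
  simp only [inner_sum, real_inner_smul_left, real_inner_smul_right,
    inner_principal_principal hA hk]
  simp only [mul_ite, mul_zero, Finset.sum_ite_eq, Finset.mem_univ, if_true]
  ring

theorem norm_sq_repr (hA : A.IsHermitian) (β : EuclideanSpace ℝ ι) :
    ∑ l, hA.eigenvectorBasis.repr β l ^ 2 = ‖β‖ ^ 2 := by
  rw [← hA.eigenvectorBasis.repr.norm_map β, EuclideanSpace.real_norm_sq_eq]

/-- Bessel's inequality. -/
theorem sum_sq_inner_normalizedPrincipal_le (hA : A.IsHermitian) {k : ι → H}
    (hk : ∀ i j, A i j = inner ℝ (k i) (k j)) (x : H) :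
    ∑ l, inner ℝ x (normalizedPrincipal hA k l) ^ 2 ≤ ‖x‖ ^ 2 := by
  have hpos := eigenvalues_nonneg_of_gram hA hk
  set c : ι → ℝ := fun l => inner ℝ x (normalizedPrincipal hA k l) with hc
  have h1 : inner ℝ x (∑ l, c l • normalizedPrincipal hA k l) = ∑ l, c l ^ 2 := by
    rw [inner_sum]
    exact Finset.sum_congr rfl fun l _ => by rw [real_inner_smul_right, hc, sq]
  have h2 : ‖∑ l, c l • normalizedPrincipal hA k l‖ ^ 2 ≤ ∑ l, c l ^ 2 := by
    simp only [normalizedPrincipal, smul_smul]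
    rw [norm_sq_sum_smul_principal hA hk]
    refine Finset.sum_le_sum fun l _ => ?_
    rw [mul_pow, inv_pow, Real.sq_sqrt (hpos l), mul_assoc]
    -- Only $\lambda^{-1}\lambda\le1$ is needed, so zero eigenvalues, where the inverse is $0$ by
    -- convention, need no separate case.
    exact mul_le_of_le_one_right (sq_nonneg _) (inv_mul_le_one)
  have h3 := sq_nonneg ‖x - ∑ l, c l • normalizedPrincipal hA k l‖
  rw [norm_sub_sq_real, h1] at h3
  linarith

/-- The rank one operator `x ⊗ x` as a Hilbert-Schmidt operator, given by its values at the
normalized principal vectors. -/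
noncomputable def rankOne (hA : A.IsHermitian) (k : ι → H) (x : H) : PiLp 2 fun _ : ι => H :=
  WithLp.toLp 2 fun l => inner ℝ x (normalizedPrincipal hA k l) • x

theorem norm_rankOne_le (hA : A.IsHermitian) {k : ι → H}
    (hk : ∀ i j, A i j = inner ℝ (k i) (k j)) (x : H) : ‖rankOne hA k x‖ ≤ ‖x‖ ^ 2 := by
  refine le_of_sq_le_sq ?_ (sq_nonneg _)
  rw [PiLp.norm_sq_eq_of_L2]
  simp only [rankOne, norm_smul, mul_pow, Real.norm_eq_abs, sq_abs]
  rw [← Finset.sum_mul, sq (‖x‖ ^ 2)]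
  exact mul_le_mul_of_nonneg_right (sum_sq_inner_normalizedPrincipal_le hA hk x) (sq_nonneg _)

/-- The coefficients, with respect to the normalized principal vectors, of the preimage under
`∑ i, k i ⊗ k i` of the projection of `∑ i, β i • k i` to the principal vectors in `s`. -/
noncomputable def preimageCoeff (hA : A.IsHermitian) (s : Finset ι) (β : EuclideanSpace ℝ ι)
    (l : ι) : ℝ :=
  if l ∈ s then hA.eigenvectorBasis.repr β l / √(hA.eigenvalues l) else 0

theorem sum_sq_preimageCoeff_le (hA : A.IsHermitian) {s : Finset ι} {a : ℝ} (ha : 0 < a)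
    (hs : ∀ l ∈ s, a ≤ hA.eigenvalues l) (β : EuclideanSpace ℝ ι) :
    ∑ l, preimageCoeff hA s β l ^ 2 ≤ ‖β‖ ^ 2 / a := by
  rw [← norm_sq_repr hA, Finset.sum_div]
  refine Finset.sum_le_sum fun l _ => ?_
  unfold preimageCoeff
  split_ifs with hl
  · rw [div_pow, Real.sq_sqrt (ha.le.trans (hs l hl))]
    have := hs l hl
    gcongr
  · rw [zero_pow two_ne_zero]; positivity

/-- For $u_l=p_l/\sqrt{\lambda_l}$ one has $Tu_l=\sqrt{\lambda_l}\,p_l$, and the division by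
$\sqrt{\lambda_l}$ in `preimageCoeff` cancels this factor. -/
theorem sum_preimageCoeff_smul (hA : A.IsHermitian) {k : ι → H}
    (hk : ∀ i j, A i j = inner ℝ (k i) (k j)) {s : Finset ι}
    (hs : ∀ l ∈ s, 0 < hA.eigenvalues l) (β : EuclideanSpace ℝ ι) :
    ∑ l, preimageCoeff hA s β l • (∑ i, rankOne hA k (k i)) l =
      ∑ l ∈ s, hA.eigenvectorBasis.repr β l • principal hA k l := by
  rw [← Finset.sum_subset (Finset.subset_univ s) fun l _ hl => by
    rw [preimageCoeff, if_neg hl, zero_smul]]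
  refine Finset.sum_congr rfl fun l hl => ?_
  have h0 : √(hA.eigenvalues l) ≠ 0 := (Real.sqrt_pos.2 (hs l hl)).ne'
  have h1 : (∑ i, rankOne hA k (k i)) l = √(hA.eigenvalues l) • principal hA k l := by
    rw [WithLp.ofLp_sum, Finset.sum_apply]
    simp only [rankOne, normalizedPrincipal, real_inner_smul_right, mul_smul]
    rw [← Finset.smul_sum, sum_inner_smul_principal hA hk, smul_smul]
    congr 1
    rw [inv_mul_eq_div, Real.div_sqrt]
  rw [h1, preimageCoeff, if_pos hl, smul_smul, div_mul_cancel₀ _ h0]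

theorem norm_sq_sum_sub_sum_le (hA : A.IsHermitian) {k : ι → H}
    (hk : ∀ i j, A i j = inner ℝ (k i) (k j)) {s : Finset ι} {a : ℝ}
    (ha : 0 ≤ a) (hs : ∀ l ∉ s, hA.eigenvalues l ≤ a) (β : EuclideanSpace ℝ ι) :
    ‖∑ l ∈ s, hA.eigenvectorBasis.repr β l • principal hA k l - ∑ i, β i • k i‖ ^ 2 ≤
      ‖β‖ ^ 2 * a := by
  have h : ∑ l ∈ s, hA.eigenvectorBasis.repr β l • principal hA k l - ∑ i, β i • k i =
      -∑ l, (if l ∈ s then 0 else hA.eigenvectorBasis.repr β l) • principal hA k l := by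
    rw [sum_smul_eq_sum_smul_principal hA, ← Fintype.sum_ite_mem, ← Finset.sum_sub_distrib,
      ← Finset.sum_neg_distrib]
    refine Finset.sum_congr rfl fun l _ => ?_
    split_ifs <;> simp
  rw [h, norm_neg, norm_sq_sum_smul_principal hA hk, ← norm_sq_repr hA, Finset.sum_mul]
  refine Finset.sum_le_sum fun l _ => ?_
  split_ifs with hl
  · rw [zero_pow two_ne_zero, zero_mul]; positivity
  · exact mul_le_mul_of_nonneg_left (hs l hl) (sq_nonneg _)

end Spectral

/-! ### Approximation from the span of the sampled vectors. -/

section Sampling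

variable {H : Type*} [NormedAddCommGroup H] [InnerProductSpace ℝ H] {n D : ℕ}
  {A : Matrix (Fin n × Fin D) (Fin n × Fin D) ℝ}

/-- The contribution of a sample point to `∑ i, k i ⊗ k i`. -/
noncomputable def pointOperator (hA : A.IsHermitian) (k : Fin n × Fin D → H) (j : Fin n) :
    PiLp 2 fun _ : Fin n × Fin D => H :=
  ∑ i, rankOne hA k (k (j, i))

/-- The contribution of a sample point to `∑ i, k i ⊗ k i`, centred. -/
noncomputable def centredOperator (hA : A.IsHermitian) (k : Fin n × Fin D → H) (j : Fin n) :
    PiLp 2 fun _ : Fin n × Fin D => H :=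
  pointOperator hA k j - (n : ℝ)⁻¹ • ∑ j', pointOperator hA k j'

theorem sum_centredOperator (hA : A.IsHermitian) (k : Fin n × Fin D → H) (hn : 0 < n) :
    ∑ j, centredOperator hA k j = 0 := by
  have hn' : (n : ℝ) ≠ 0 := by positivity
  simp only [centredOperator, Finset.sum_sub_distrib, Finset.sum_const, Finset.card_univ,
    Fintype.card_fin]
  rw [← Nat.cast_smul_eq_nsmul ℝ, smul_smul, mul_inv_cancel₀ hn', one_smul, sub_self]

theorem norm_centredOperator_le (hA : A.IsHermitian) {k : Fin n × Fin D → H}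
    (hk : ∀ i j, A i j = inner ℝ (k i) (k j)) {c : ℝ} (hc : ∀ j, ∑ i, ‖k (j, i)‖ ^ 2 ≤ c)
    (j : Fin n) : ‖centredOperator hA k j‖ ≤ 2 * c := by
  have h1 : ∀ j, ‖pointOperator hA k j‖ ≤ c := fun j =>
    ((norm_sum_le _ _).trans (Finset.sum_le_sum fun i _ => norm_rankOne_le hA hk _)).trans (hc j)
  have hn : (0 : ℝ) < n := by exact_mod_cast j.pos
  have h2 : ‖(n : ℝ)⁻¹ • ∑ j', pointOperator hA k j'‖ ≤ c := by
    rw [norm_smul, norm_inv, Real.norm_natCast, inv_mul_le_iff₀ hn]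
    refine (norm_sum_le _ _).trans ((Finset.sum_le_sum fun j _ => h1 j).trans (le_of_eq ?_))
    simp
  calc _ ≤ _ := norm_sub_le _ _
    _ ≤ _ := by linarith [h1 j]

/-- If the empirical covariance operator of the points `J` is close to the full one, then the span
of the vectors at the points `J` approximates all vectors `∑ i, β i • k i`. -/
theorem exists_mem_span_norm_sub_le (hA : A.IsHermitian) {k : Fin n × Fin D → H}
    (hk : ∀ i j, A i j = inner ℝ (k i) (k j)) {m : ℕ} (hn : 0 < n) (hm : 0 < m)
    (J : Fin m → Fin n) {ρ : ℝ}
    (hJ : ‖∑ j, centredOperator hA k (J j)‖ ≤ ρ) {r : ℕ}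
    (hr : r = 0 ∨ 0 < sortedEigenvalue hA r) (β : EuclideanSpace ℝ (Fin n × Fin D)) :
    ∃ v ∈ Submodule.span ℝ (Set.range fun p : Fin m × Fin D => k (J p.1, p.2)),
      ‖v - ∑ i, β i • k i‖ ^ 2 ≤
        ‖β‖ ^ 2 * (2 * (if r = 0 then 0 else (n * ρ / m) ^ 2 / sortedEigenvalue hA r) +
          2 * sortedEigenvalue hA (r + 1)) := by
  have hn' : (n : ℝ) ≠ 0 := by positivity
  have hm' : (m : ℝ) ≠ 0 := by positivity
  obtain ⟨s, hs1, hs2⟩ := exists_finset_sortedEigenvalue hA hr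
  have hpos := eigenvalues_nonneg_of_gram hA hk
  have hs0 : ∀ l ∈ s, 0 < hA.eigenvalues l := fun l hl =>
    (hr.resolve_left (hs1 l hl).1).trans_le (hs1 l hl).2
  set c := preimageCoeff hA s β with hc
  set hproj := ∑ l ∈ s, hA.eigenvectorBasis.repr β l • principal hA k l with hp
  set Z := ∑ j, centredOperator hA k (J j) with hZ
  have hZ' : ∑ j, pointOperator hA k (J j) =
      Z + (m / n : ℝ) • ∑ i, rankOne hA k (k i) := by
    simp only [hZ, centredOperator, Finset.sum_sub_distrib, Finset.sum_const, Finset.card_univ,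
      Fintype.card_fin]
    rw [← Nat.cast_smul_eq_nsmul ℝ, smul_smul, ← div_eq_mul_inv, Fintype.sum_prod_type]
    simp only [pointOperator, sub_add_cancel]
  -- The rescaled empirical operator is applied to the preimage of the head; its range lies in the
  -- span of the sampled vectors.
  set v := (n / m : ℝ) • ∑ l, c l • (∑ j, pointOperator hA k (J j)) l with hv
  have hdiff : v - hproj = (n / m : ℝ) • ∑ l, c l • Z l := by
    rw [hv, hZ']
    simp only [PiLp.add_apply, PiLp.smul_apply, smul_add, Finset.sum_add_distrib,
      smul_comm (c _) (m / n : ℝ)]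
    rw [← Finset.smul_sum, hc, sum_preimageCoeff_smul hA hk hs0, smul_smul,
      div_mul_div_cancel₀ hm', div_self hn', one_smul, add_sub_cancel_right]
  refine ⟨v, ?_, ?_⟩
  · refine Submodule.smul_mem _ _ (Submodule.sum_mem _ fun l _ => Submodule.smul_mem _ _ ?_)
    simp only [pointOperator, WithLp.ofLp_sum, Finset.sum_apply]
    refine Submodule.sum_mem _ fun j _ => Submodule.sum_mem _ fun i _ => ?_
    exact Submodule.smul_mem _ _ (Submodule.subset_span ⟨(j, i), rfl⟩)
  · have h1 : ‖v - hproj‖ ^ 2 ≤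
        ‖β‖ ^ 2 * (if r = 0 then 0 else (n * ρ / m) ^ 2 / sortedEigenvalue hA r) := by
      rw [hdiff, norm_smul, mul_pow, Real.norm_eq_abs, sq_abs]
      have h2 := norm_sq_sum_smul_le c Z
      split_ifs with hr0
      -- For `r = 0` the set `s` is empty: the head vanishes and there is no sampling error.
      · have hcz : ∀ l, c l = 0 := fun l =>
          if_neg fun hl => (hs1 l hl).1 hr0
        simp [hcz]
      · have hlam := hr.resolve_left hr0
        have h3 := sum_sq_preimageCoeff_le hA hlam (fun l hl => (hs1 l hl).2) β
        calc _ ≤ (n / m : ℝ) ^ 2 * (‖β‖ ^ 2 / sortedEigenvalue hA r * ρ ^ 2) := by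
              gcongr
              exact h2.trans (by gcongr)
          _ = _ := by field_simp
    have h4 := norm_sq_sum_sub_sum_le hA hk (sortedEigenvalue_nonneg hA hpos (r + 1)) hs2 β
    rw [← hp] at h4
    have h5 : ‖v - ∑ i, β i • k i‖ ^ 2 ≤
        2 * (‖v - hproj‖ ^ 2 + ‖hproj - ∑ i, β i • k i‖ ^ 2) := by
      refine le_trans ?_ add_sq_le
      gcongr
      exact norm_sub_le_norm_sub_add_norm_sub _ _ _
    linarith

end Sampling

/-! ### Transfer to the Banach space and its covariance operator. -/

section Space

variable {U : Type*} [NormedAddCommGroup U] [NormedSpace ℝ U] {𝒦 : StrongDual ℝ U ≃ₗ[ℝ] U}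

/-- The inner product `⟪x, y⟫ = [𝒦⁻¹ x, y]`, which induces the norm of `U`. -/
@[reducible]
noncomputable def IsCovarianceOperator.innerProductSpace (h𝒦 : IsCovarianceOperator 𝒦) :
    InnerProductSpace ℝ U where
  toNormedSpace := inferInstance
  inner x y := 𝒦.symm x y
  norm_sq_eq_re_inner x := h𝒦.norm_sq x
  conj_inner_symm x y := by
    have := h𝒦.symm (𝒦.symm x) (𝒦.symm y)
    simpa using this
  add_left x y z := by simp
  smul_left x y r := by simp

theorem IsCovarianceOperator.gramEigenvalue_nonneg (h𝒦 : IsCovarianceOperator 𝒦) {ι : Type*}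
    [Fintype ι] [DecidableEq ι] (ψ : ι → StrongDual ℝ U) (r : ℕ) :
    0 ≤ gramEigenvalue h𝒦 ψ r := by
  let _ := h𝒦.innerProductSpace
  refine sortedEigenvalue_nonneg _ (eigenvalues_nonneg_of_gram (k := fun i => 𝒦 (ψ i)) _ ?_) r
  intro i j
  exact (congrArg (fun φ : StrongDual ℝ U => φ (𝒦 (ψ j))) (𝒦.symm_apply_apply (ψ i))).symm

/-- With probability at least `1 - δ / 2`, the span of the functionals at the inducing points
approximates all combinations of the functionals at the samples. -/
theorem IsCovarianceOperator.measure_not_approx_le (h𝒦 : IsCovarianceOperator 𝒦) {C₀ : ℝ}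
    (hC₀ : 0 < C₀) {X : Type*} [TopologicalSpace X] {n D m : ℕ} (L : Fin D → (U →L[ℝ] C(X, ℝ)))
    (x : Fin n → X) (htr : ∀ j, (gram 𝒦 fun i => pointFunctional (L i) (x j)).trace ≤ C₀)
    (hm : 0 < m) {S : Type*} [MeasurableSpace S] {P : Measure S} [IsProbabilityMeasure P]
    {I : Fin m → S → Fin n} (hI : IsUniformSample P I) {δ : ℝ} (hδ : 0 < δ) (hδ1 : δ < 1) :
    P {s | ∀ r, (r = 0 ∨ 0 < gramEigenvalue h𝒦 (functionals L x) r) →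
      ∀ β : EuclideanSpace ℝ (Fin n × Fin D),
        ∃ v ∈ Ha 𝒦 (functionals L fun j => x (I j s)),
          ‖v - ∑ i, β i • 𝒦 (functionals L x i)‖ ^ 2 ≤ ‖β‖ ^ 2 *
            (samplingTerm (256 * C₀ ^ 2) δ n m (gramEigenvalue h𝒦 (functionals L x)) r / 2 +
              2 * gramEigenvalue h𝒦 (functionals L x) (r + 1))}ᶜ ≤ ENNReal.ofReal (δ / 2) := by
  let _ := h𝒦.innerProductSpace
  obtain ⟨s₀⟩ : Nonempty S := nonempty_of_isProbabilityMeasure P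
  -- A drawn index exists, so there is at least one sample.
  have hn : 0 < n := (I ⟨0, hm⟩ s₀).pos
  set k : Fin n × Fin D → U := fun i => 𝒦 (functionals L x i) with hkdef
  have hA := h𝒦.gram_isHermitian (functionals L x)
  have hk : ∀ i j, gram 𝒦 (functionals L x) i j = inner ℝ (k i) (k j) := fun i j =>
    (congrArg (fun φ : StrongDual ℝ U => φ (k j)) (𝒦.symm_apply_apply (functionals L x i))).symm
  have hsum : ∀ j, ∑ i, ‖k (j, i)‖ ^ 2 ≤ C₀ := fun j => by
    refine le_trans (le_of_eq ?_) (htr j)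
    rw [Matrix.trace]
    refine Finset.sum_congr rfl fun i _ => ?_
    rw [← real_inner_self_eq_norm_sq, ← hk]
    rfl
  set ℓ := Real.log (2 / δ) with hℓ
  -- Chosen so that the tail $2e^{1-t}$ equals $\delta/2$. Since $\delta<1$, $\ln2\le\ell$ and
  -- $1\le2\ln2$ give $t=1+\ln2+\ell\le4\ell$.
  set t := 1 + Real.log (4 / δ) with ht
  have htail := hI.measure_lt_norm_sum_le hm hn (sum_centredOperator hA k hn)
    (B := 2 * C₀) (by positivity) (norm_centredOperator_le hA hk hsum) t
  have hexp : 2 * Real.exp (1 - t) = δ / 2 := by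
    rw [ht, sub_add_cancel_left, Real.exp_neg, Real.exp_log (by positivity)]
    field_simp
    norm_num
  have htℓ : t ≤ 4 * ℓ := by
    have h1 : Real.log (4 / δ) = Real.log 2 + ℓ := by
      rw [hℓ, ← Real.log_mul (by norm_num) (by positivity)]
      congr 1; ring
    have h2 : Real.log 2 ≤ ℓ :=
      Real.log_le_log (by norm_num) (by rw [le_div_iff₀ hδ]; linarith)
    have := Real.log_two_gt_d9
    rw [ht, h1]; linarith
  rw [hexp] at htail
  refine (measure_mono ?_).trans htail
  intro s hs
  simp only [Set.mem_ofPred_eq]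
  by_contra hcon
  refine hs fun r hr β => ?_
  have hρ : ‖∑ j, centredOperator hA k (I j s)‖ ≤ 2 * C₀ * √m * (4 * ℓ) :=
    (not_lt.1 hcon).trans (by gcongr)
  obtain ⟨v, hv, hle⟩ := exists_mem_span_norm_sub_le hA hk hn hm (fun j => I j s) hρ hr β
  refine ⟨v, hv, hle.trans (le_of_eq ?_)⟩
  congr 2
  unfold samplingTerm
  split_ifs with hr0
  · simp
  · have hm' : (m : ℝ) ≠ 0 := by positivity
    have hlam : sortedEigenvalue hA r ≠ 0 := (hr.resolve_left hr0).ne'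
    have hsq : √(m : ℝ) ^ 2 = m := Real.sq_sqrt (Nat.cast_nonneg m)
    -- The constant: $2\,(n\cdot8C_0\sqrt m\,\ell/m)^2/\lambda_r=128\,C_0^2n^2\ell^2/(\lambda_rm)$,
    -- half of the term with $C=256C_0^2$.
    change 2 * (_ / sortedEigenvalue hA r) = _ / (sortedEigenvalue hA r * m) / 2
    rw [div_pow, mul_pow, mul_pow, mul_pow, hsq]
    field_simp
    ring

theorem worstError_le {ι κ : Type*} [Fintype ι] {ψ : ι → StrongDual ℝ U}
    {φ : κ → StrongDual ℝ U} {b : ℝ}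
    (h : ∀ β : EuclideanSpace ℝ ι, ‖β‖ ≤ 1 →
      ∃ v ∈ Ha 𝒦 φ, ‖v - ∑ i, β i • 𝒦 (ψ i)‖ ^ 2 ≤ b) :
    worstError 𝒦 ψ φ ≤ b := by
  refine csSup_le (Set.Nonempty.image _ ⟨0, 0, by simp, by simp⟩) ?_
  rintro _ ⟨_, ⟨β, hβ, rfl⟩, rfl⟩
  obtain ⟨v, hv, hle⟩ := h β hβ
  refine (ciInf_le ⟨0, ?_⟩ (⟨v, hv⟩ : Ha 𝒦 φ)).trans hle
  rintro _ ⟨w, rfl⟩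
  positivity

end Space

/-! ### Combination of interior and boundary. -/

theorem add_sq_le_of_sq_le_mul {a₁ a₂ b₁ b₂ e₁ e₂ : ℝ} (h₁ : e₁ ^ 2 ≤ b₁ * a₁)
    (h₂ : e₂ ^ 2 ≤ b₂ * a₂) (ha₁ : 0 ≤ a₁) (ha₂ : 0 ≤ a₂) (hb₁ : 0 ≤ b₁) (hb₂ : 0 ≤ b₂)
    (hb : b₁ + b₂ ≤ 1) : (e₁ + e₂) ^ 2 ≤ a₁ + a₂ := by
  have h3 : (e₁ * e₂) ^ 2 ≤ (b₁ * a₂) * (b₂ * a₁) := by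
    calc (e₁ * e₂) ^ 2 = e₁ ^ 2 * e₂ ^ 2 := by ring
      _ ≤ (b₁ * a₁) * (b₂ * a₂) := by gcongr
      _ = _ := by ring
  -- The arithmetic-geometric mean inequality for the cross term; the result is Cauchy-Schwarz,
  -- $(e_1+e_2)^2\le(b_1+b_2)(a_1+a_2)$. In the application $b_1,b_2$ are the squared norms of the
  -- two blocks of $\beta$.
  have h4 : 2 * (e₁ * e₂) ≤ b₁ * a₂ + b₂ * a₁ := by
    refine le_of_sq_le_sq ?_ (by positivity)
    nlinarith [sq_nonneg (b₁ * a₂ - b₂ * a₁)]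
  nlinarith [mul_nonneg (sub_nonneg.2 hb) (add_nonneg ha₁ ha₂)]

theorem samplingTerm_nonneg {C δ : ℝ} (hC : 0 ≤ C) {n m : ℕ} {μ : ℕ → ℝ} {r : ℕ}
    (hμ : 0 ≤ μ r) : 0 ≤ samplingTerm C δ n m μ r := by
  unfold samplingTerm
  split_ifs <;> positivity

/-- The argument uses only subadditivity of the outer measure, so the events need not be measurable.
-/
theorem ofReal_one_sub_le_measure_inter {S : Type*} [MeasurableSpace S] {P : Measure S}
    [IsProbabilityMeasure P] {s t : Set S} {δ : ℝ} (hδ : 0 < δ)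
    (hs : P sᶜ ≤ ENNReal.ofReal (δ / 2)) (ht : P tᶜ ≤ ENNReal.ofReal (δ / 2)) :
    ENNReal.ofReal (1 - δ) ≤ P (s ∩ t) := by
  rw [ENNReal.ofReal_sub _ hδ.le, ENNReal.ofReal_one, tsub_le_iff_right]
  calc 1 = P (s ∩ t ∪ (s ∩ t)ᶜ) := by rw [Set.union_compl_self, measure_univ]
    _ ≤ P (s ∩ t) + P (sᶜ ∪ tᶜ) := by
        rw [← Set.compl_inter]; exact measure_union_le _ _
    _ ≤ P (s ∩ t) + (P sᶜ + P tᶜ) := by gcongr; exact measure_union_le _ _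
    _ ≤ P (s ∩ t) + (ENNReal.ofReal (δ / 2) + ENNReal.ofReal (δ / 2)) := by gcongr
    _ = P (s ∩ t) + ENNReal.ofReal δ := by
        rw [← ENNReal.ofReal_add (by positivity) (by positivity), add_halves]

end Nystrom

theorem theorem3p6 (C₀ : ℝ) (hC₀ : 0 < C₀) :
    ∃ C : ℝ, 0 < C ∧
      ∀ (U : Type u) [NormedAddCommGroup U] [NormedSpace ℝ U] [CompleteSpace U]
        (𝒦 : StrongDual ℝ U ≃ₗ[ℝ] U) (h𝒦 : Nystrom.IsCovarianceOperator 𝒦)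
        (d : ℕ) (Ω : Set (EuclideanSpace ℝ (Fin d))) (_ : IsOpen Ω) (_ : Bornology.IsBounded Ω)
        -- the interior and the boundary operators
        (D_int D_bd : ℕ)
        (L_int : Fin D_int → (U →L[ℝ] C(Ω, ℝ)))
        (L_bd : Fin D_bd → (U →L[ℝ] C(frontier Ω, ℝ)))
        -- the interior and the boundary samples
        (N_int N_bd : ℕ) (x_int : Fin N_int → Ω) (x_bd : Fin N_bd → frontier Ω)
        -- the traces at the sample points are bounded by `C₀`
        (_ : ∀ j, (Nystrom.gram 𝒦 fun i =>
          Nystrom.pointFunctional (L_int i) (x_int j)).trace ≤ C₀)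
        (_ : ∀ j, (Nystrom.gram 𝒦 fun i =>
          Nystrom.pointFunctional (L_bd i) (x_bd j)).trace ≤ C₀)
        -- the inducing points are drawn uniformly from the samples
        (M_int M_bd : ℕ) (_ : 0 < M_int) (_ : 0 < M_bd)
        (S : Type v) [MeasurableSpace S] (P : MeasureTheory.Measure S)
        [MeasureTheory.IsProbabilityMeasure P]
        (I_int : Fin M_int → S → Fin N_int) (I_bd : Fin M_bd → S → Fin N_bd)
        (_ : Nystrom.IsUniformSample P I_int) (_ : Nystrom.IsUniformSample P I_bd)
        (δ : ℝ) (_ : 0 < δ) (_ : δ < 1),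
        ENNReal.ofReal (1 - δ) ≤
          P {s | ∀ r₁ ≤ N_int * D_int, ∀ r₂ ≤ N_bd * D_bd,
            -- the right-hand side is infinite if `λ_{r₁} = 0` or `τ_{r₂} = 0`
            (r₁ = 0 ∨ 0 < Nystrom.gramEigenvalue h𝒦 (Nystrom.functionals L_int x_int) r₁) →
            (r₂ = 0 ∨ 0 < Nystrom.gramEigenvalue h𝒦 (Nystrom.functionals L_bd x_bd) r₂) →
            Nystrom.worstError 𝒦 (Nystrom.allFunctionals L_int L_bd x_int x_bd)
                (Nystrom.allFunctionals L_int L_bd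
                  (fun j => x_int (I_int j s)) (fun j => x_bd (I_bd j s))) ≤
              max (Nystrom.samplingTerm C δ N_int M_int
                    (Nystrom.gramEigenvalue h𝒦 (Nystrom.functionals L_int x_int)) r₁)
                  (Nystrom.samplingTerm C δ N_bd M_bd
                    (Nystrom.gramEigenvalue h𝒦 (Nystrom.functionals L_bd x_bd)) r₂)
                + 4 * Nystrom.gramEigenvalue h𝒦 (Nystrom.functionals L_int x_int) (r₁ + 1)
                + 4 * Nystrom.gramEigenvalue h𝒦 (Nystrom.functionals L_bd x_bd) (r₂ + 1)} := by
  refine ⟨256 * C₀ ^ 2, by positivity, ?_⟩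
  intro U _ _ _ 𝒦 h𝒦 d Ω _ _ D_int D_bd L_int L_bd N_int N_bd x_int x_bd htr_int htr_bd
    M_int M_bd hM_int hM_bd S _ P _ I_int I_bd hI_int hI_bd δ hδ hδ1
  refine (Nystrom.ofReal_one_sub_le_measure_inter hδ
    (h𝒦.measure_not_approx_le hC₀ L_int x_int htr_int hM_int hI_int hδ hδ1)
    (h𝒦.measure_not_approx_le hC₀ L_bd x_bd htr_bd hM_bd hI_bd hδ hδ1)).trans
    (MeasureTheory.measure_mono ?_)
  rintro s ⟨hs_int, hs_bd⟩ r₁ _ r₂ _ hr₁ hr₂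
  have hlam := h𝒦.gramEigenvalue_nonneg (Nystrom.functionals L_int x_int)
  have htau := h𝒦.gramEigenvalue_nonneg (Nystrom.functionals L_bd x_bd)
  have hC : 0 ≤ 256 * C₀ ^ 2 := by positivity
  have hq₁ := Nystrom.samplingTerm_nonneg (δ := δ) (n := N_int) (m := M_int) hC (hlam r₁)
  have hq₂ := Nystrom.samplingTerm_nonneg (δ := δ) (n := N_bd) (m := M_bd) hC (htau r₂)
  have hlam' := hlam (r₁ + 1)
  have htau' := htau (r₂ + 1)
  refine Nystrom.worstError_le fun β hβ => ?_
  obtain ⟨v₁, hv₁, h₁⟩ := hs_int r₁ hr₁ (WithLp.toLp 2 fun i => β (Sum.inl i))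
  obtain ⟨v₂, hv₂, h₂⟩ := hs_bd r₂ hr₂ (WithLp.toLp 2 fun i => β (Sum.inr i))
  refine ⟨v₁ + v₂, Submodule.add_mem _ ?_ ?_, ?_⟩
  · refine Submodule.span_mono ?_ hv₁
    rintro _ ⟨i, rfl⟩
    exact ⟨Sum.inl i, rfl⟩
  · refine Submodule.span_mono ?_ hv₂
    rintro _ ⟨i, rfl⟩
    exact ⟨Sum.inr i, rfl⟩
  · have hnorm : ‖(WithLp.toLp 2 fun i => β (Sum.inl i) : EuclideanSpace ℝ (Fin N_int × Fin D_int))‖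
          ^ 2 + ‖(WithLp.toLp 2 fun i => β (Sum.inr i) : EuclideanSpace ℝ (Fin N_bd × Fin D_bd))‖
          ^ 2 ≤ 1 := by
      have h := pow_le_one₀ (n := 2) (norm_nonneg β) hβ
      rw [EuclideanSpace.real_norm_sq_eq, Fintype.sum_sum_type] at h
      rwa [EuclideanSpace.real_norm_sq_eq, EuclideanSpace.real_norm_sq_eq]
    have hsq := Nystrom.add_sq_le_of_sq_le_mul h₁ h₂ (by positivity) (by positivity)
      (sq_nonneg _) (sq_nonneg _) hnorm
    have htri : ‖v₁ + v₂ - ∑ i, β i • 𝒦 (Nystrom.allFunctionals L_int L_bd x_int x_bd i)‖ ≤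
        ‖v₁ - ∑ i, β (Sum.inl i) • 𝒦 (Nystrom.functionals L_int x_int i)‖ +
          ‖v₂ - ∑ i, β (Sum.inr i) • 𝒦 (Nystrom.functionals L_bd x_bd i)‖ := by
      rw [Fintype.sum_sum_type, add_sub_add_comm]
      exact norm_add_le _ _
    refine (pow_le_pow_left₀ (norm_nonneg _) htri 2).trans (hsq.trans ?_)
    -- Each side contributes half of its sampling term, and the mean of two numbers is at most their
    -- maximum; the tails enter with factor 2, below the allowed 4.
    linarith [le_max_left (Nystrom.samplingTerm (256 * C₀ ^ 2) δ N_int M_int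
        (Nystrom.gramEigenvalue h𝒦 (Nystrom.functionals L_int x_int)) r₁)
        (Nystrom.samplingTerm (256 * C₀ ^ 2) δ N_bd M_bd
        (Nystrom.gramEigenvalue h𝒦 (Nystrom.functionals L_bd x_bd)) r₂),
      le_max_right (Nystrom.samplingTerm (256 * C₀ ^ 2) δ N_int M_int
        (Nystrom.gramEigenvalue h𝒦 (Nystrom.functionals L_int x_int)) r₁)
        (Nystrom.samplingTerm (256 * C₀ ^ 2) δ N_bd M_bd
        (Nystrom.gramEigenvalue h𝒦 (Nystrom.functionals L_bd x_bd)) r₂)]
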